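/- Let $d\ge 1$ and let $\mathbf X=(X,\Sigma,\mu,T)$ be a $\mathbb Z^d$-system, i.e. a $\mu$-preserving action $T$ of $\mathbb Z^d$ on a standard Borel probability space $(X,\Sigma,\mu)$; let $e_1,\dots,e_d$ be the standard basis of $\mathbb Z^d$. An extension of $\mathbf X$ is a $\mathbb Z^d$-system $\tilde{\mathbf X}$ together with a factor map $\pi:\tilde{\mathbf X}\to\mathbf X$, i.e. a measure-preserving equivariant map. For $v\in\mathbb Z^d$ let $\mathsf Z_0^{v}$ be the class of all $\mathbb Z^d$-systems on which $T^{v}$ is almost everywhere the identity, and let $$\mathsf C:=\mathsf Z_0^{e_1}\vee\bigvee_{j=2}^d\mathsf Z_0^{e_1-e_j}$$ be the class of all joinings of members of these classes, i.e. of all systems that have a factor map to a member of each of these classes such that these factor maps together generate the whole $\sigma$-algebra up to null sets. Every system $\mathbf Y$ has a maximal $\mathsf C$-factor: the $\sigma$-subalgebra, unique up to null sets, that is largest among those generated by factor maps from $\mathbf Y$ to members of $\mathsf C$. The system $\mathbf X$ is called $\mathsf C$-sated if for every extension $\pi:\tilde{\mathbf X}\to\mathbf X$, with $\Xi$ denoting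 the $\pi$-preimage of the maximal $\mathsf C$-factor of $\mathbf X$, $$\int fg\,d\tilde\mu=\int \mathsf E_{\tilde\mu}(f\mid\Xi)\,\mathsf E_{\tilde\mu}(g\mid\Xi)\,d\tilde\mu$$ for all $f,g\in L^\infty(\tilde\mu)$ such that $f$ is $\pi^{-1}(\Sigma)$-measurable and $g$ is measurable with respect to the maximal $\mathsf C$-factor of $\tilde{\mathbf X}$. For $v\in\mathbb Z^d$ let $\Sigma^{T^{v}}$ be the $\sigma$-algebra of all $A\in\Sigma$ that are invariant under $T^{v}$ up to $\mu$-null sets, write $\Sigma^{T^{e_1}=T^{e_j}}:=\Sigma^{T^{e_1-e_j}}$, and let $$\Phi:=\Sigma^{T^{e_1}}\vee\bigvee_{j=2}^d\Sigma^{T^{e_1}=T^{e_j}}.$$ Proposition. Suppose that $\mathbf X$ is $\mathsf C$-sated and that $f_1,\dots,f_d\in L^\infty(\mu)$ (complex-valued). If the averages $$S_N(f_1,\dots,f_d):=\frac1N\sum_{n=1}^N (f_1\circ T^{ne_1})(f_2\circ T^{ne_2})\cdots(f_d\circ T^{ne_d})$$ do not tend to $0$ in $L^2(\mu)$ as $N\to\infty$,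 then $\mathsf E_\mu(f_1\mid\Phi)\ne 0$ (as an element of $L^\infty(\mu)$). (This property of $\Phi$ is expressed by saying that the factor $\Phi$ is partially characteristic.) -/

import Mathlib

open MeasureTheory Filter
open scoped Topology ENNReal

universe u v

/-- A probability-preserving action of the (discrete, Abelian, additively written) group `Γ` on a
standard Borel probability space. -/
structure PPSystem (Γ : Type v) [AddCommGroup Γ] where
  carrier : Type u
  [mspace : MeasurableSpace carrier]
  [standard : StandardBorelSpace carrier]
  μ : Measure carrier
  [prob : IsProbabilityMeasure μ]
  T : Γ → carrier → carrier
  T_zero : T 0 = id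
  T_add : ∀ γ δ : Γ, T (γ + δ) = T γ ∘ T δ
  T_measurePreserving : ∀ γ : Γ, MeasurePreserving (T γ) μ μ

attribute [instance] PPSystem.mspace PPSystem.standard PPSystem.prob

namespace PPSystem

/-- Inclusion of `σ`-subalgebras up to negligible sets: every member of `m₁` agrees with a member
of `m₂` off a `ν`-null set. -/
def LEModNull {Ω : Type u} {m₀ : MeasurableSpace Ω} (ν : Measure Ω) (m₁ m₂ : MeasurableSpace Ω) : Prop :=
  ∀ s : Set Ω, MeasurableSet[m₁] s → ∃ t : Set Ω, MeasurableSet[m₂] t ∧ s =ᵐ[ν] t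

variable {Γ : Type v} [AddCommGroup Γ]

/-- Factor maps of `Γ`-systems. If `IsFactorMap X Y π`, then `X` together with `π` is an extension
of `Y`. -/
structure IsFactorMap (X Y : PPSystem.{u} Γ) (π : X.carrier → Y.carrier) : Prop where
  measurePreserving : MeasurePreserving π X.μ Y.μ
  equivariant : ∀ γ : Γ, Y.T γ ∘ π = π ∘ X.T γ

/-- A factor, as a globally `T`-invariant `σ`-subalgebra. -/
def IsFactor (X : PPSystem.{u} Γ) (Φ : MeasurableSpace X.carrier) : Prop :=
  Φ ≤ X.mspace ∧ ∀ γ : Γ, ∀ A : Set X.carrier, MeasurableSet[Φ] A → MeasurableSet[Φ] (X.T γ ⁻¹' A)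

/-- The `Λ`-partially invariant factor: the `σ`-algebra of all measurable sets that are invariant,
up to negligible sets, under the subaction of `Λ`. -/
@[reducible] def invariantFactor (X : PPSystem.{u} Γ) (Λ : AddSubgroup Γ) : MeasurableSpace X.carrier where
  MeasurableSet' A := MeasurableSet A ∧ ∀ γ ∈ Λ, X.T γ ⁻¹' A =ᵐ[X.μ] A
  measurableSet_empty := ⟨MeasurableSet.empty, fun _ _ => by simp⟩
  measurableSet_compl A hA := ⟨hA.1.compl, fun γ hγ => (hA.2 γ hγ).compl⟩
  measurableSet_iUnion A hA := by
    refine ⟨MeasurableSet.iUnion fun i => (hA i).1, fun γ hγ => ?_⟩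
    rw [Set.preimage_iUnion]
    exact Filter.EventuallyEq.countable_iUnion fun i => (hA i).2 γ hγ

theorem isFactor_invariantFactor (X : PPSystem.{u} Γ) (Λ : AddSubgroup Γ) :
    X.IsFactor (X.invariantFactor Λ) := by
  refine ⟨fun A hA => hA.1, fun γ A hA => ⟨(X.T_measurePreserving γ).measurable hA.1, ?_⟩⟩
  intro δ hδ
  have h : X.T δ ⁻¹' (X.T γ ⁻¹' A) = X.T γ ⁻¹' (X.T δ ⁻¹' A) := by
    rw [← Set.preimage_comp, ← Set.preimage_comp, ← X.T_add, ← X.T_add, add_comm]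
  rw [h]
  exact (X.T_measurePreserving γ).quasiMeasurePreserving.preimage_ae_eq (hA.2 δ hδ)

/-- Classes of `Γ`-systems. -/
abbrev SystemClass (Γ : Type v) [AddCommGroup Γ] : Type (max (u + 1) v) := PPSystem.{u} Γ → Prop

/-- The class `Z₀^Λ` of all systems on which the subaction of `Λ` is trivial. -/
def Zzero (Λ : AddSubgroup Γ) : SystemClass.{u} Γ :=
  fun X => ∀ γ ∈ Λ, X.T γ =ᵐ[X.μ] id

/-- The join of two classes: all joinings of a member of the first with a member of the second. -/
def join (C D : SystemClass.{u} Γ) : SystemClass.{u} Γ :=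
  fun X => ∃ (Y Z : PPSystem.{u} Γ) (π : X.carrier → Y.carrier) (ψ : X.carrier → Z.carrier),
    C Y ∧ D Z ∧ IsFactorMap X Y π ∧ IsFactorMap X Z ψ ∧
      LEModNull X.μ X.mspace (Y.mspace.comap π ⊔ Z.mspace.comap ψ)

/-- The join of a finite family of classes: all joinings of members of these classes. (For the empty
family these are the trivial systems.) -/
def iJoin {ι : Type} [Fintype ι] (C : ι → SystemClass.{u} Γ) : SystemClass.{u} Γ :=
  fun X => ∃ (Y : ι → PPSystem.{u} Γ) (π : (i : ι) → X.carrier → (Y i).carrier),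
    (∀ i, C i (Y i)) ∧ (∀ i, IsFactorMap X (Y i) (π i)) ∧
      LEModNull X.μ X.mspace (⨆ i, (Y i).mspace.comap (π i))

/-- The `σ`-subalgebras of `X` that are generated by a factor map to a system in `C`. -/
def factorsIn (C : SystemClass.{u} Γ) (X : PPSystem.{u} Γ) : Set (MeasurableSpace X.carrier) :=
  {Ξ | ∃ (Y : PPSystem.{u} Γ) (π : X.carrier → Y.carrier),
    C Y ∧ IsFactorMap X Y π ∧ Ξ = Y.mspace.comap π}

/-- The maximal `C`-factor of `X`, as a `σ`-subalgebra: the supremum of all the `σ`-subalgebras that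
are generated by factor maps to systems in `C`. For an idempotent class this family has a member
that contains all the others up to negligible sets, and any such member agrees with the supremum up
to negligible sets, by `maxFactor_eqModNull` below. -/
@[reducible] def maxFactor (C : SystemClass.{u} Γ) (X : PPSystem.{u} Γ) : MeasurableSpace X.carrier :=
  sSup (factorsIn C X)

theorem maxFactor_eqModNull (C : SystemClass.{u} Γ) (X : PPSystem.{u} Γ)
    (Ξ : MeasurableSpace X.carrier) (hΞ : Ξ ∈ factorsIn C X)
    (hmax : ∀ Ξ' ∈ factorsIn C X, LEModNull X.μ Ξ' Ξ) :
    LEModNull X.μ (maxFactor C X) Ξ ∧ LEModNull X.μ Ξ (maxFactor C X) := by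
  refine ⟨?_, fun s hs => ⟨s, (le_sSup hΞ : Ξ ≤ maxFactor C X) s hs, ae_eq_refl _⟩⟩
  let m : MeasurableSpace X.carrier :=
    { MeasurableSet' := fun s => ∃ t, MeasurableSet[Ξ] t ∧ s =ᵐ[X.μ] t
      measurableSet_empty := ⟨∅, MeasurableSpace.measurableSet_empty Ξ, ae_eq_refl _⟩
      measurableSet_compl := fun s ⟨t, ht, hst⟩ =>
        ⟨tᶜ, MeasurableSpace.measurableSet_compl Ξ t ht, hst.compl⟩
      measurableSet_iUnion := fun s hs => by
        choose t ht hst using hs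
        exact ⟨⋃ i, t i, MeasurableSpace.measurableSet_iUnion Ξ t ht,
          Filter.EventuallyEq.countable_iUnion hst⟩ }
  have h : maxFactor C X ≤ m := sSup_le fun Ξ' hΞ' => hmax Ξ' hΞ'
  exact fun s hs => h s hs

/-- The pair of `σ`-subalgebras `(m₁, m₂)` is relatively independent over `Ξ`. -/
def RelIndep {Ω : Type u} {m₀ : MeasurableSpace Ω} (ν : Measure Ω) (m₁ m₂ Ξ : MeasurableSpace Ω) :
    Prop :=
  ∀ f g : Ω → ℂ, StronglyMeasurable[m₁] f → MemLp f ∞ ν → StronglyMeasurable[m₂] g → MemLp g ∞ ν →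
    ∫ x, f x * g x ∂ν = ∫ x, (ν[f|Ξ]) x * (ν[g|Ξ]) x ∂ν

/-- `X` is `C`-sated: for every extension `π : X' → X`, the factor map `π` and the maximal
`C`-factor of `X'` are relatively independent over the lift to `X'` of the maximal `C`-factor
of `X`. -/
def IsSated (C : SystemClass.{u} Γ) (X : PPSystem.{u} Γ) : Prop :=
  ∀ (X' : PPSystem.{u} Γ) (π : X'.carrier → X.carrier), IsFactorMap X' X π →
    RelIndep X'.μ (X.mspace.comap π) (maxFactor C X') ((maxFactor C X).comap π)

section Averages

/-- The standard basis vector `e i` of `ℤ^d`. -/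
def e {d : ℕ} (i : Fin d) : Fin d → ℤ := Pi.single i 1

/-- The averages `S_N(f_1, …, f_d) = (1/N) ∑_{n=1}^N ∏_i f_i ∘ T^{n e_i}`. -/
noncomputable def avg {d : ℕ} (X : PPSystem.{u} (Fin d → ℤ)) (f : Fin d → X.carrier → ℂ) (N : ℕ) :
    X.carrier → ℂ :=
  fun x => (N : ℂ)⁻¹ * ∑ n ∈ Finset.Icc 1 N, ∏ i, f i (X.T (n • e i) x)

/-- For a `ℤ^d`-system with `d = k + 1` (so that the indices `1, 2, …, d` become `0, 1, …, k`), the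
class `Z₀^{e_1} ∨ ⋁_{j=2}^d Z₀^{e_1 - e_j}`. -/
def charClass (k : ℕ) : SystemClass.{u} (Fin (k + 1) → ℤ) :=
  join (Zzero (AddSubgroup.zmultiples (e 0)))
    (iJoin fun j : Fin k => Zzero (AddSubgroup.zmultiples (e 0 - e j.succ)))

/-- The `σ`-algebra `Σ^{T^{e_1}} ∨ ⋁_{j=2}^d Σ^{T^{e_1} = T^{e_j}}`, again with `d = k + 1`. -/
@[reducible] def charFactor {k : ℕ} (X : PPSystem.{u} (Fin (k + 1) → ℤ)) : MeasurableSpace X.carrier :=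
  X.invariantFactor (AddSubgroup.zmultiples (e 0)) ⊔
    ⨆ j : Fin k, X.invariantFactor (AddSubgroup.zmultiples (e 0 - e j.succ))

theorem isFactor_charFactor {k : ℕ} (X : PPSystem.{u} (Fin (k + 1) → ℤ)) :
    X.IsFactor X.charFactor := by
  have key := fun Λ => X.isFactor_invariantFactor Λ
  refine ⟨sup_le (key _).1 (iSup_le fun j => (key _).1), fun γ => ?_⟩
  have h : X.charFactor ≤ X.charFactor.map (X.T γ) := by
    refine sup_le (fun A hA => ?_) (iSup_le fun j A hA => ?_)
    · exact (le_sup_left : _ ≤ X.charFactor) _ ((key _).2 γ A hA)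
    · exact ((le_iSup (fun j : Fin k => X.invariantFactor
        (AddSubgroup.zmultiples (e 0 - e j.succ))) j).trans le_sup_right : _ ≤ X.charFactor) _
        ((key _).2 γ A hA)
  exact fun A hA => h A hA

end Averages

end PPSystem

/-!
The proof passes through a Furstenberg self-joining, taken along an ultrafilter so that no
convergence theorem for multiple averages is needed.

Suppose that the averages do not tend to `0`. By the van der Corput inequality
(`PPSystem.integral_sq_norm_average_le`), `‖S_N‖²` is at most, up to `O(H/N)`, the integral of
`|A_H F|²` with respect to the law of `(T^{n e_1} x, …, T^{n e_d} x)`, where `n ≤ N` is random, `F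
= f_1 ⊗ ⋯ ⊗ f_d`, and `A_H` is the ergodic average of length `H` for `τ = T^{e_1} × ⋯ × T^{e_d}`.
All these laws are self-couplings of `μ`, hence tight, and they have a limit `ν` along a
nonprincipal ultrafilter that contains the set of all `N` with `‖S_N‖` large
(`PPSystem.exists_furstenbergJoining`). A Polish topology in which the action and the `f_i` are
continuous (`exists_polishSpace_continuous`) makes weak convergence carry over both the lower
bound for `∫ |A_H F|²` and the invariance of `ν` under `τ` and under the diagonal action. By the
mean ergodic theorem some set `A`, `τ`-invariant up to null sets, satisfies `∫_A F dν ≠ 0`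
(`exists_aeInvariant_setIntegral_ne_zero`).

On `(X^d, ν)` let `e_1` act by `τ` and every other `e_j` diagonally. The first coordinate makes
this an extension of `X`. The set `A` is invariant under `e_1`, and the `j`-th coordinate, for `j
≥ 2`, is a factor map to a system on which `e_1` and `e_j` act in the same way. Hence `1_A ∏_{j ≥
2} f_j(x_j)` is measurable for the maximal factor of the extension
(`PPSystem.stronglyMeasurable_maxFactor_productSystem`). On the other hand, the maximal factor of
`X` is contained in `Φ` up to null sets (`PPSystem.maxFactor_charClass_le`), so if `E(f_1 | Φ) =
0` then satedness gives `∫ f_1(x_1) 1_A ∏_{j ≥ 2} f_j(x_j) dν = 0`, a contradiction.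
-/

/-! ### Polish topologies adapted to a countable family of maps -/

/-- A Borel map on a Polish space is continuous for a finer Polish topology, which generates the
same `σ`-algebra by the Lusin–Souslin theorem. -/
theorem exists_finer_polishSpace_continuous {X E : Type*} [mX : MeasurableSpace X]
    (t : TopologicalSpace X) (ht : PolishSpace X) (hb : BorelSpace X) [TopologicalSpace E]
    [SecondCountableTopology E] [MeasurableSpace E] [OpensMeasurableSpace E] {g : X → E}
    (hg : Measurable g) :
    ∃ t' : TopologicalSpace X, (@PolishSpace X t' ∧ @BorelSpace X t' mX) ∧ t' ≤ t ∧
      @Continuous X E t' _ g := by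
  obtain ⟨t', hle, hc, hp⟩ := hg.exists_continuous
  exact ⟨t', ⟨hp, @BorelSpace.mk X t' mX
    (hb.measurable_eq.trans (borel_eq_borel_of_le hp ht hle).symm)⟩, hle, hc⟩

/-- Countably many measurable self-maps and countably many measurable functions on a standard Borel
space are all continuous for a suitable Polish topology that generates the given `σ`-algebra. Such
a topology is the supremum of a sequence of finer and finer Polish topologies for which each of the
self-maps is continuous from one topology to the preceding one. -/
theorem exists_polishSpace_continuous {X ι κ E : Type*} [mX : MeasurableSpace X]
    [StandardBorelSpace X] [Countable ι] [Countable κ] [TopologicalSpace E]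
    [SecondCountableTopology E] [MeasurableSpace E] [BorelSpace E]
    (T : ι → X → X) (hT : ∀ i, Measurable (T i)) (f : κ → X → E) (hf : ∀ j, Measurable (f j)) :
    ∃ _ : TopologicalSpace X, PolishSpace X ∧ BorelSpace X ∧ (∀ i, Continuous (T i)) ∧
      ∀ j, Continuous (f j) := by
  let P := {t : TopologicalSpace X // @PolishSpace X t ∧ @BorelSpace X t mX}
  have step : ∀ t : P, ∃ t' : P, t'.1 ≤ t.1 ∧ ∀ i, @Continuous X X t'.1 t.1 (T i) := by
    rintro ⟨t, ht, hb⟩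
    obtain ⟨t', ht', hle, hc⟩ := exists_finer_polishSpace_continuous t ht hb
      (measurable_pi_lambda (fun x i => T i x) hT)
    exact ⟨⟨t', ht'⟩, hle,
      fun i => @Continuous.comp X (ι → X) X t' (@Pi.topologicalSpace ι _ fun _ => t) t _ _
        (@continuous_apply ι (fun _ => X) (fun _ => t) i) hc⟩
  choose next next_le next_cont using step
  obtain ⟨t₁, ht₁, -, hf₁⟩ := exists_finer_polishSpace_continuous
    (upgradeStandardBorel X).toTopologicalSpace inferInstance inferInstance
    (measurable_pi_lambda (fun x j => f j x) hf)
  let s : ℕ → P := fun n => Nat.rec ⟨t₁, ht₁⟩ (fun _ t => next t) n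
  have hs : ∀ n, (s n).1 ≤ (s 0).1 := fun n => by
    induction n with
    | zero => exact le_rfl
    | succ n ih => exact (next_le (s n)).trans ih
  have hp : @PolishSpace X (⨅ n, (s n).1) := .iInf ⟨0, hs⟩ fun n => (s n).2.1
  refine ⟨⨅ n, (s n).1, hp, ?_, fun i => ?_, fun j => ?_⟩
  · exact @BorelSpace.mk X (⨅ n, (s n).1) mX
      ((@BorelSpace.measurable_eq X (s 0).1 mX (s 0).2.2).trans
      (borel_eq_borel_of_le hp (s 0).2.1 (iInf_le _ 0)).symm)
  · exact continuous_iInf_rng.2 fun n => continuous_le_dom (iInf_le _ (n + 1)) (next_cont (s n) i)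
  · refine continuous_le_dom (iInf_le _ 0) ?_
    exact @Continuous.comp X (κ → E) E t₁ _ _ _ _ (continuous_apply j) hf₁

/-! ### Limits of couplings -/

/-- Couplings of fixed probability measures on a Polish space are relatively compact: they converge
weakly along any ultrafilter. -/
theorem exists_tendsto_of_marginals {X ι α : Type*} [Fintype ι] [TopologicalSpace X] [PolishSpace X]
    [MeasurableSpace X] [BorelSpace X] (μ : Measure X) [IsFiniteMeasure μ]
    (m : α → ProbabilityMeasure (ι → X))
    (hm : ∀ a i, (m a : Measure (ι → X)).map (fun x => x i) = μ) (U : Ultrafilter α) :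
    ∃ ν : ProbabilityMeasure (ι → X), Tendsto m U (𝓝 ν) := by
  have tight : IsTightMeasureSet {((p : ProbabilityMeasure (ι → X)) : Measure (ι → X)) |
      p ∈ Set.range m} := by
    rw [isTightMeasureSet_iff_exists_isCompact_measure_compl_le]
    intro ε hε
    obtain ⟨δ, hδ, hδε⟩ : ∃ δ : ℝ≥0∞, 0 < δ ∧ Fintype.card ι * δ ≤ ε := by
      refine ⟨ε / (Fintype.card ι), ENNReal.div_pos hε.ne' (by simp), ?_⟩
      exact ENNReal.mul_div_le
    obtain ⟨K, hK, hμK⟩ := isTightMeasureSet_iff_exists_isCompact_measure_compl_le.1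
      (isTightMeasureSet_singleton (μ := μ)) δ hδ
    refine ⟨Set.univ.pi fun _ => K, isCompact_univ_pi fun _ => hK, ?_⟩
    rintro _ ⟨_, ⟨a, rfl⟩, rfl⟩
    have hsub : (Set.univ.pi fun _ : ι => K)ᶜ ⊆ ⋃ i, (fun x : ι → X => x i) ⁻¹' Kᶜ := by
      intro x hx
      simpa [Set.mem_pi] using hx
    calc (m a : Measure (ι → X)) (Set.univ.pi fun _ : ι => K)ᶜ
        ≤ ∑ i, (m a : Measure (ι → X)) ((fun x : ι → X => x i) ⁻¹' Kᶜ) :=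
          (measure_mono hsub).trans (measure_iUnion_fintype_le _ _)
      _ ≤ ∑ _i : ι, δ := by
          refine Finset.sum_le_sum fun i _ => ?_
          rw [← Measure.map_apply (measurable_pi_apply i) hK.measurableSet.compl, hm]
          exact hμK μ rfl
      _ ≤ ε := by simpa using hδε
  obtain ⟨ν, -, hν⟩ := (isCompact_closure_of_isTightMeasureSet tight).ultrafilter_le_nhds (U.map m)
    (le_principal_iff.2 (Filter.mem_of_superset (Filter.range_mem_map) subset_closure))
  exact ⟨ν, hν⟩

/-! ### An inequality of van der Corput type -/

theorem norm_sum_sub_sum_shift_le {u : ℕ → ℂ} {C : ℝ} (hu : ∀ n, ‖u n‖ ≤ C) (N h : ℕ) :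
    ‖∑ n ∈ Finset.Icc 1 N, u n - ∑ n ∈ Finset.Icc 1 N, u (n + h)‖ ≤ 2 * h * C := by
  induction h with
  | zero => simp
  | succ h ih =>
    have tele : ∀ M : ℕ, ∑ n ∈ Finset.Icc 1 M, u (n + h) - ∑ n ∈ Finset.Icc 1 M, u (n + (h + 1))
        = u (1 + h) - u (M + 1 + h) := by
      intro M
      induction M with
      | zero => simp
      | succ M ihM =>
        rw [Finset.sum_Icc_succ_top (by omega), Finset.sum_Icc_succ_top (by omega),
          add_sub_add_comm, ihM, show M + 1 + (h + 1) = M + 1 + 1 + h by ring]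
        ring
    have h2 : ‖u (1 + h) - u (N + 1 + h)‖ ≤ 2 * C :=
      (norm_sub_le _ _).trans (by linarith [hu (1 + h), hu (N + 1 + h)])
    rw [← sub_add_sub_cancel _ (∑ n ∈ Finset.Icc 1 N, u (n + h)), tele N]
    refine (norm_add_le _ _).trans ?_
    push_cast
    linarith

/-- The square of a long average is bounded, up to a small error, by the average of the squares of
short averages. -/
theorem sq_norm_average_le {u : ℕ → ℂ} {C : ℝ} (hu : ∀ n, ‖u n‖ ≤ C) {N H : ℕ} (hN : 0 < N)
    (hH : 0 < H) :
    ‖(N : ℂ)⁻¹ * ∑ n ∈ Finset.Icc 1 N, u n‖ ^ 2 ≤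
      (N : ℝ)⁻¹ * ∑ n ∈ Finset.Icc 1 N, ‖(H : ℂ)⁻¹ * ∑ h ∈ Finset.range H, u (n + h)‖ ^ 2 +
        4 * H * C ^ 2 / N := by
  have hN' : (0 : ℝ) < N := by exact_mod_cast hN
  have hH' : (0 : ℝ) < H := by exact_mod_cast hH
  have hHC : (H : ℂ) ≠ 0 := by exact_mod_cast hH.ne'
  have hC : 0 ≤ C := (norm_nonneg _).trans (hu 0)
  set w : ℕ → ℂ := fun n => (H : ℂ)⁻¹ * ∑ h ∈ Finset.range H, u (n + h) with hw
  have avg_le : ∀ z : ℕ → ℂ, (∀ n, ‖z n‖ ≤ C) → ‖(N : ℂ)⁻¹ * ∑ n ∈ Finset.Icc 1 N, z n‖ ≤ C := by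
    intro z hz
    rw [norm_mul, norm_inv, Complex.norm_natCast, inv_mul_le_iff₀ hN']
    refine (norm_sum_le _ _).trans ((Finset.sum_le_sum fun n _ => hz n).trans ?_)
    simp
  have hwC : ∀ n, ‖w n‖ ≤ C := by
    intro n
    rw [hw, norm_mul, norm_inv, Complex.norm_natCast, inv_mul_le_iff₀ hH']
    refine (norm_sum_le _ _).trans ((Finset.sum_le_sum fun h _ => hu (n + h)).trans ?_)
    simp
  set a := (N : ℂ)⁻¹ * ∑ n ∈ Finset.Icc 1 N, u n with ha
  set b := (N : ℂ)⁻¹ * ∑ n ∈ Finset.Icc 1 N, w n with hb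
  have ha' : ‖a‖ ≤ C := avg_le u hu
  have hb' : ‖b‖ ≤ C := avg_le w hwC
  have hab : ‖a - b‖ ≤ 2 * H * C / N := by
    have : a - b = (N : ℂ)⁻¹ * ((H : ℂ)⁻¹ * ∑ h ∈ Finset.range H,
        (∑ n ∈ Finset.Icc 1 N, u n - ∑ n ∈ Finset.Icc 1 N, u (n + h))) := by
      rw [Finset.sum_sub_distrib, Finset.sum_const, Finset.card_range, nsmul_eq_mul, mul_sub,
        inv_mul_cancel_left₀ hHC, ha, hb, ← mul_sub, hw, ← Finset.mul_sum, Finset.sum_comm]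
    rw [this, norm_mul, norm_mul, norm_inv, norm_inv, Complex.norm_natCast, Complex.norm_natCast,
      inv_mul_le_iff₀ hN', inv_mul_le_iff₀ hH', mul_div_cancel₀ _ hN'.ne']
    refine (norm_sum_le _ _).trans ((Finset.sum_le_sum (g := fun _ => 2 * H * C)
      fun h hh => (norm_sum_sub_sum_shift_le hu N h).trans ?_).trans ?_)
    · have : (h : ℝ) ≤ H := by exact_mod_cast (Finset.mem_range.1 hh).le
      gcongr
    · simp
  have hbsq : ‖b‖ ^ 2 ≤ (N : ℝ)⁻¹ * ∑ n ∈ Finset.Icc 1 N, ‖w n‖ ^ 2 := by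
    have h1 : ‖b‖ ≤ (N : ℝ)⁻¹ * ∑ n ∈ Finset.Icc 1 N, ‖w n‖ := by
      rw [hb, norm_mul, norm_inv, Complex.norm_natCast]
      gcongr
      exact norm_sum_le _ _
    have h2 := sq_sum_le_card_mul_sum_sq (s := Finset.Icc 1 N) (f := fun n => ‖w n‖)
    rw [Nat.card_Icc, Nat.add_sub_cancel] at h2
    calc ‖b‖ ^ 2 ≤ ((N : ℝ)⁻¹ * ∑ n ∈ Finset.Icc 1 N, ‖w n‖) ^ 2 := by gcongr
      _ = (N : ℝ)⁻¹ * ((N : ℝ)⁻¹ * (∑ n ∈ Finset.Icc 1 N, ‖w n‖) ^ 2) := by ring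
      _ ≤ (N : ℝ)⁻¹ * ∑ n ∈ Finset.Icc 1 N, ‖w n‖ ^ 2 := by
        gcongr
        rwa [inv_mul_le_iff₀ hN']
  have htri : ‖a‖ - ‖b‖ ≤ 2 * H * C / N := (norm_sub_norm_le a b).trans hab
  have hsq : ‖a‖ ^ 2 - ‖b‖ ^ 2 ≤ 4 * H * C ^ 2 / N := by
    calc ‖a‖ ^ 2 - ‖b‖ ^ 2 = (‖a‖ + ‖b‖) * (‖a‖ - ‖b‖) := by ring
      _ ≤ (‖a‖ + ‖b‖) * (2 * H * C / N) := by gcongr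
      _ ≤ (C + C) * (2 * H * C / N) := by gcongr
      _ = 4 * H * C ^ 2 / N := by ring
  linarith

/-! ### The Furstenberg self-joining along an ultrafilter -/

namespace PPSystem

variable {Γ : Type v} [AddCommGroup Γ] {ι : Type*}

/-- The law of the point `(T^{n v_i} x)_i`, where `x` has law `μ` and `n` is uniformly distributed
on `{1, …, N}`. (For `N = 0` this is the junk value `0`.) -/
noncomputable def empiricalJoining (X : PPSystem.{u} Γ) (v : ι → Γ) (N : ℕ) :
    Measure (ι → X.carrier) :=
  (N : ℝ≥0∞)⁻¹ • ∑ n ∈ Finset.Icc 1 N, X.μ.map (fun x i => X.T (n • v i) x)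

theorem measurable_orbit (X : PPSystem.{u} Γ) (w : ι → Γ) :
    Measurable fun (x : X.carrier) i => X.T (w i) x :=
  measurable_pi_lambda _ fun i => (X.T_measurePreserving (w i)).measurable

theorem measurable_diag (X : PPSystem.{u} Γ) (w : ι → Γ) :
    Measurable fun (x : ι → X.carrier) i => X.T (w i) (x i) :=
  measurable_pi_lambda _ fun i =>
    (X.T_measurePreserving (w i)).measurable.comp (measurable_pi_apply i)

theorem T_T (X : PPSystem.{u} Γ) (γ δ : Γ) (x : X.carrier) : X.T γ (X.T δ x) = X.T (γ + δ) x := by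
  rw [X.T_add]; rfl

theorem inv_natCast_mul_sum_Icc_one {N : ℕ} (hN : 0 < N) (a : ℝ≥0∞) :
    (N : ℝ≥0∞)⁻¹ * ∑ _n ∈ Finset.Icc 1 N, a = a := by
  rw [Finset.sum_const, Nat.card_Icc, Nat.add_sub_cancel, nsmul_eq_mul, ← mul_assoc,
    ENNReal.inv_mul_cancel (by exact_mod_cast hN.ne') (by simp), one_mul]

theorem map_eval_empiricalJoining (X : PPSystem.{u} Γ) (v : ι → Γ) {N : ℕ} (hN : 0 < N) (i : ι) :
    (X.empiricalJoining v N).map (fun x => x i) = X.μ := by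
  ext s hs
  rw [Measure.map_apply (measurable_pi_apply i) hs, empiricalJoining, Measure.smul_apply,
    Measure.finsetSum_apply, smul_eq_mul]
  have : ∀ n ∈ Finset.Icc 1 N, X.μ.map (fun x i => X.T (n • v i) x)
      ((fun x : ι → X.carrier => x i) ⁻¹' s) = X.μ s := fun n _ => by
    rw [Measure.map_apply (X.measurable_orbit _) (measurable_pi_apply i hs)]
    exact (X.T_measurePreserving (n • v i)).measure_preimage hs.nullMeasurableSet
  rw [Finset.sum_congr rfl this, inv_natCast_mul_sum_Icc_one hN]

theorem isProbabilityMeasure_empiricalJoining (X : PPSystem.{u} Γ) (v : ι → Γ) {N : ℕ}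
    (hN : 0 < N) : IsProbabilityMeasure (X.empiricalJoining v N) := by
  refine ⟨?_⟩
  rw [empiricalJoining, Measure.smul_apply, Measure.finsetSum_apply, smul_eq_mul]
  have : ∀ n ∈ Finset.Icc 1 N, X.μ.map (fun x i => X.T (n • v i) x) Set.univ = 1 := fun n _ => by
    rw [Measure.map_apply (X.measurable_orbit _) .univ, Set.preimage_univ, measure_univ]
  rw [Finset.sum_congr rfl this, inv_natCast_mul_sum_Icc_one hN]

theorem integral_empiricalJoining (X : PPSystem.{u} Γ) (v : ι → Γ) (N : ℕ)
    {φ : (ι → X.carrier) → ℝ} (hφ : Measurable φ) {C : ℝ} (hC : ∀ x, ‖φ x‖ ≤ C) :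
    ∫ x, φ x ∂X.empiricalJoining v N =
      (N : ℝ)⁻¹ * ∑ n ∈ Finset.Icc 1 N, ∫ x, φ (fun i => X.T (n • v i) x) ∂X.μ := by
  rw [empiricalJoining, integral_smul_measure, integral_finsetSum_measure]
  · simp only [smul_eq_mul, ENNReal.toReal_inv, ENNReal.toReal_natCast]
    congr 1
    refine Finset.sum_congr rfl fun n _ => ?_
    exact integral_map (X.measurable_orbit _).aemeasurable hφ.aestronglyMeasurable
  · intro n _
    have : IsProbabilityMeasure (X.μ.map fun x i => X.T (n • v i) x) :=
      Measure.isProbabilityMeasure_map (X.measurable_orbit _).aemeasurable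
    exact Integrable.of_bound hφ.aestronglyMeasurable C (.of_forall hC)

theorem birkhoffAverage_orbit (X : PPSystem.{u} Γ) (v : ι → Γ) (F : (ι → X.carrier) → ℂ) (H n : ℕ)
    (x : X.carrier) :
    birkhoffAverage ℂ (fun (y : ι → X.carrier) i => X.T (v i) (y i)) F H
        (fun i => X.T (n • v i) x) =
      (H : ℂ)⁻¹ * ∑ h ∈ Finset.range H, F (fun i => X.T ((n + h) • v i) x) := by
  rw [birkhoffAverage, birkhoffSum, smul_eq_mul]
  congr 1
  refine Finset.sum_congr rfl fun h hh => congrArg F ?_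
  clear hh
  induction h with
  | zero => simp
  | succ h ih =>
    rw [Function.iterate_succ_apply', ih]
    funext i
    rw [T_T, ← add_assoc, succ_nsmul' _ (n + h)]

theorem norm_birkhoffAverage_le_of_bound {α : Type*} (τ : α → α) {F : α → ℂ} {C : ℝ}
    (hC : ∀ x, ‖F x‖ ≤ C) (H : ℕ) (x : α) : ‖birkhoffAverage ℂ τ F H x‖ ≤ C := by
  have h0 : 0 ≤ C := (norm_nonneg _).trans (hC x)
  rcases H.eq_zero_or_pos with rfl | hH
  · simpa using h0
  rw [birkhoffAverage, birkhoffSum, norm_smul, norm_inv, Complex.norm_natCast,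
    inv_mul_le_iff₀ (by exact_mod_cast hH)]
  refine (norm_sum_le _ _).trans ((Finset.sum_le_sum fun h _ => hC _).trans ?_)
  simp

/-- The van der Corput inequality for the averages of `F (T^{n v_i} x)_i`: the right hand side is an
integral against the empirical joining of the orbits. -/
theorem integral_sq_norm_average_le (X : PPSystem.{u} Γ) (v : ι → Γ) {F : (ι → X.carrier) → ℂ}
    (hF : Measurable F) {C : ℝ} (hC : ∀ x, ‖F x‖ ≤ C) {N H : ℕ} (hN : 0 < N) (hH : 0 < H) :
    ∫ x, ‖(N : ℂ)⁻¹ * ∑ n ∈ Finset.Icc 1 N, F (fun i => X.T (n • v i) x)‖ ^ 2 ∂X.μ ≤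
      ∫ y, ‖birkhoffAverage ℂ (fun (y : ι → X.carrier) i => X.T (v i) (y i)) F H y‖ ^ 2
        ∂X.empiricalJoining v N + 4 * H * C ^ 2 / N := by
  have hτ : Measurable fun (y : ι → X.carrier) i => X.T (v i) (y i) := X.measurable_diag v
  have hB : Measurable (birkhoffAverage ℂ (fun (y : ι → X.carrier) i => X.T (v i) (y i)) F H) := by
    exact (Finset.measurable_sum (Finset.range H) fun h _ => hF.comp (hτ.iterate h)).const_mul
      (H : ℂ)⁻¹
  have hBC := norm_birkhoffAverage_le_of_bound
    (fun (y : ι → X.carrier) i => X.T (v i) (y i)) hC H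
  have int : ∀ {g : X.carrier → ℂ}, Measurable g → (∀ x, ‖g x‖ ≤ C) →
      Integrable (fun x => ‖g x‖ ^ 2) X.μ := fun hg hgC =>
    Integrable.of_bound (hg.norm.pow_const 2).aestronglyMeasurable (C ^ 2) (.of_forall fun x => by
      rw [norm_pow, norm_norm]
      exact pow_le_pow_left₀ (norm_nonneg _) (hgC x) 2)
  have intB : ∀ n ∈ Finset.Icc 1 N, Integrable (fun x => ‖birkhoffAverage ℂ
      (fun (y : ι → X.carrier) i => X.T (v i) (y i)) F H fun i => X.T (n • v i) x‖ ^ 2) X.μ :=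
    fun n _ => int (hB.comp (X.measurable_orbit fun i => n • v i)) fun x => hBC _
  rw [X.integral_empiricalJoining v N (hB.norm.pow_const 2) (C := C ^ 2) fun y => by
    rw [norm_pow, norm_norm]
    exact pow_le_pow_left₀ (norm_nonneg _) (hBC y) 2]
  rw [← integral_finsetSum _ intB, ← integral_const_mul]
  have : ∫ _x, 4 * H * C ^ 2 / N ∂X.μ = 4 * H * C ^ 2 / N := by simp
  rw [← this, ← integral_add ((integrable_finsetSum _ intB).const_mul _) (integrable_const _)]
  refine integral_mono_of_nonneg (.of_forall fun x => by positivity)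
    (((integrable_finsetSum _ intB).const_mul _).add (integrable_const _)) (.of_forall fun x => ?_)
  simp only [birkhoffAverage_orbit]
  exact sq_norm_average_le (u := fun n => F fun i => X.T (n • v i) x) (fun n => hC _) hN hH

/-- Let the averages of `∏ i, f i (T^{n v_i} x)` have `L²`-norm bounded below along infinitely many
`N`. Then some self-joining `ν` of `X`, namely a limit of the empirical joinings along an
ultrafilter, is invariant under the diagonal action and under the transformation `∏ i, T^{v_i}`, and
the ergodic averages of `⊗ f_i` for the latter have `L²`-norm bounded below. -/
theorem exists_furstenbergJoining [Countable Γ] [Fintype ι] (X : PPSystem.{u} Γ) (v : ι → Γ)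
    {f : ι → X.carrier → ℂ} (hf : ∀ i, Measurable (f i)) {C : ℝ} (hC : ∀ i x, ‖f i x‖ ≤ C) {ε : ℝ}
    (hε : ∃ᶠ N : ℕ in atTop,
      ε ≤ ∫ x, ‖(N : ℂ)⁻¹ * ∑ n ∈ Finset.Icc 1 N, ∏ i, f i (X.T (n • v i) x)‖ ^ 2 ∂X.μ) :
    ∃ ν : Measure (ι → X.carrier), IsProbabilityMeasure ν ∧
      (∀ i, MeasurePreserving (fun x : ι → X.carrier => x i) ν X.μ) ∧
      (∀ γ, MeasurePreserving (fun (x : ι → X.carrier) i => X.T γ (x i)) ν ν) ∧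
      MeasurePreserving (fun (x : ι → X.carrier) i => X.T (v i) (x i)) ν ν ∧
      ∀ H : ℕ, 0 < H → ε ≤ ∫ y, ‖birkhoffAverage ℂ
        (fun (y : ι → X.carrier) i => X.T (v i) (y i)) (fun y => ∏ i, f i (y i)) H y‖ ^ 2 ∂ν := by
  obtain ⟨t, _, _, hT, hfc⟩ := exists_polishSpace_continuous X.T
    (fun γ => (X.T_measurePreserving γ).measurable) f hf
  set F : (ι → X.carrier) → ℂ := fun y => ∏ i, f i (y i) with hF
  set τ : (ι → X.carrier) → (ι → X.carrier) := fun y i => X.T (v i) (y i) with hτ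
  have hFc : Continuous F := continuous_finsetProd _ fun i _ => (hfc i).comp (continuous_apply i)
  have hFC : ∀ y, ‖F y‖ ≤ C ^ Fintype.card ι := fun y => by
    rw [hF, norm_prod]
    exact (Finset.prod_le_prod (fun i _ => norm_nonneg _) fun i _ => hC i (y i)).trans_eq (by simp)
  have hdiag : ∀ w : ι → Γ, Continuous fun (y : ι → X.carrier) i => X.T (w i) (y i) := fun w =>
    continuous_pi fun i => (hT (w i)).comp (continuous_apply i)
  set S : Set ℕ := {N | ε ≤ ∫ x, ‖(N : ℂ)⁻¹ *
    ∑ n ∈ Finset.Icc 1 N, ∏ i, f i (X.T (n • v i) x)‖ ^ 2 ∂X.μ} with hS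
  -- An ultrafilter on the times with a large average.
  have hne : (atTop ⊓ 𝓟 S).NeBot := frequently_mem_iff_neBot.1 hε
  set U : Ultrafilter ℕ := Ultrafilter.of (atTop ⊓ 𝓟 S)
  have hUle : (U : Filter ℕ) ≤ atTop ⊓ 𝓟 S := Ultrafilter.of_le _
  have hUtop : (U : Filter ℕ) ≤ atTop := hUle.trans inf_le_left
  have hUS : ∀ᶠ N in (U : Filter ℕ), N ∈ S := hUle.trans inf_le_right (mem_principal_self S)
  have hU0 : ∀ᶠ N in (U : Filter ℕ), 0 < N := hUtop (eventually_gt_atTop 0)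
  -- The index `0`, for which the empirical joining is not a probability measure, is avoided.
  let m : ℕ → ProbabilityMeasure (ι → X.carrier) := fun N =>
    ⟨X.empiricalJoining v (max N 1), X.isProbabilityMeasure_empiricalJoining v (by simp)⟩
  have hm : ∀ N, 0 < N → (m N : Measure (ι → X.carrier)) = X.empiricalJoining v N := fun N hN => by
    simp [m, Nat.max_eq_left (Nat.succ_le_of_lt hN)]
  obtain ⟨ν, hν⟩ := exists_tendsto_of_marginals X.μ m
    (fun N i => X.map_eval_empiricalJoining v (by simp) i) U
  have lim : ∀ {φ : (ι → X.carrier) → ℝ} (K : ℝ), Continuous φ → (∀ y, ‖φ y‖ ≤ K) →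
      Tendsto (fun N => ∫ y, φ y ∂X.empiricalJoining v N) U
        (𝓝 (∫ y, φ y ∂(ν : Measure (ι → X.carrier)))) := by
    intro φ K hφ hK
    refine (ProbabilityMeasure.tendsto_iff_forall_integral_tendsto.1 hν
      (BoundedContinuousFunction.ofNormedAddCommGroup φ hφ K hK)).congr' ?_
    filter_upwards [hU0] with N hN
    rw [hm N hN]
    rfl
  have lim_div : ∀ K : ℝ, Tendsto (fun N : ℕ => K / N) U (𝓝 0) := fun K =>
    (tendsto_const_div_atTop_nhds_zero_nat K).mono_left hUtop
  -- A continuous self-map that preserves the empirical joinings asymptotically preserves `ν`.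
  have preserves : ∀ σ : (ι → X.carrier) → (ι → X.carrier), Continuous σ →
      (∀ φ : (ι → X.carrier) → ℝ, Continuous φ → ∀ K, (∀ y, ‖φ y‖ ≤ K) → ∀ N, 0 < N →
        |∫ y, φ (σ y) ∂X.empiricalJoining v N - ∫ y, φ y ∂X.empiricalJoining v N| ≤ 2 * K / N) →
      MeasurePreserving σ (ν : Measure (ι → X.carrier)) ν := by
    intro σ hσ h
    refine ⟨hσ.measurable, ?_⟩
    have : IsProbabilityMeasure ((ν : Measure (ι → X.carrier)).map σ) :=
      Measure.isProbabilityMeasure_map hσ.measurable.aemeasurable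
    refine ext_of_forall_integral_eq_of_IsFiniteMeasure fun φ => ?_
    rw [integral_map hσ.measurable.aemeasurable φ.continuous.aestronglyMeasurable]
    have h1 := (lim ‖φ‖ (φ.continuous.comp hσ) fun y => φ.norm_coe_le_norm _).sub
      (lim ‖φ‖ φ.continuous φ.norm_coe_le_norm)
    have h2 : Tendsto (fun N : ℕ => ∫ y, φ (σ y) ∂X.empiricalJoining v N -
        ∫ y, φ y ∂X.empiricalJoining v N) U (𝓝 0) := by
      refine squeeze_zero_norm' ?_ (lim_div (2 * ‖φ‖))
      filter_upwards [hU0] with N hN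
      exact h φ φ.continuous _ φ.norm_coe_le_norm N hN
    exact sub_eq_zero.1 (tendsto_nhds_unique h1 h2)
  refine ⟨ν, inferInstance, fun i => ?_, fun γ => ?_, ?_, fun H hH => ?_⟩
  · refine ⟨measurable_pi_apply i, ?_⟩
    have : IsProbabilityMeasure
        ((ν : Measure (ι → X.carrier)).map fun x : ι → X.carrier => x i) :=
      Measure.isProbabilityMeasure_map (measurable_pi_apply i).aemeasurable
    refine ext_of_forall_integral_eq_of_IsFiniteMeasure fun φ => ?_
    rw [integral_map (measurable_pi_apply i).aemeasurable φ.continuous.aestronglyMeasurable]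
    refine tendsto_nhds_unique (lim ‖φ‖ (φ.continuous.comp (continuous_apply i))
      fun y => φ.norm_coe_le_norm _) (tendsto_const_nhds.congr' ?_)
    filter_upwards [hU0] with N hN
    rw [← X.map_eval_empiricalJoining v hN i,
      integral_map (measurable_pi_apply i).aemeasurable φ.continuous.aestronglyMeasurable]
  · refine preserves _ (hdiag fun _ => γ) fun φ hφ K hK N hN => ?_
    have hK0 : 0 ≤ K := by
      obtain ⟨x⟩ := X.μ.nonempty_of_neZero
      exact (norm_nonneg _).trans (hK fun _ => x)
    rw [X.integral_empiricalJoining v N (φ := fun y => φ fun i => X.T γ (y i))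
      (hφ.comp (hdiag fun _ => γ)).measurable fun y => hK _,
      X.integral_empiricalJoining v N hφ.measurable hK]
    have : ∀ n : ℕ, ∫ x, φ (fun i => X.T γ (X.T (n • v i) x)) ∂X.μ =
        ∫ x, φ (fun i => X.T (n • v i) x) ∂X.μ := fun n => by
      conv_rhs => rw [← (X.T_measurePreserving γ).map_eq]
      rw [integral_map (X.T_measurePreserving γ).measurable.aemeasurable
        (f := fun x => φ fun i => X.T (n • v i) x)
        (hφ.measurable.comp (X.measurable_orbit fun i => n • v i)).aestronglyMeasurable]
      simp only [T_T, add_comm γ]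
    simp only [this, sub_self, abs_zero]
    positivity
  · refine preserves τ (hdiag v) fun φ hφ K hK N hN => ?_
    rw [X.integral_empiricalJoining v N (φ := fun y => φ (τ y)) (hφ.comp (hdiag v)).measurable
        fun y => hK _,
      X.integral_empiricalJoining v N hφ.measurable hK, ← mul_sub, ← Finset.sum_sub_distrib]
    set a : ℕ → ℝ := fun n => ∫ x, φ (fun i => X.T (n • v i) x) ∂X.μ
    have ha : ∀ n, |a n| ≤ K := fun n => by
      refine (norm_integral_le_of_norm_le_const (.of_forall fun x => hK _)).trans_eq ?_
      simp
    have step : ∀ n : ℕ, ∫ x, φ (τ fun i => X.T (n • v i) x) ∂X.μ = a (n + 1) := fun n => by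
      simp only [a, hτ, T_T, succ_nsmul']
    have tele : ∀ M : ℕ, ∑ n ∈ Finset.Icc 1 M, (a (n + 1) - a n) = a (M + 1) - a 1 := fun M => by
      induction M with
      | zero => simp
      | succ M ih => rw [Finset.sum_Icc_succ_top (by omega), ih]; ring
    have hsum : ∑ n ∈ Finset.Icc 1 N, (∫ x, φ (τ fun i => X.T (n • v i) x) ∂X.μ - a n) =
        a (N + 1) - a 1 := by
      simp only [step, tele]
    rw [hsum, abs_mul, abs_inv, Nat.abs_cast, inv_mul_eq_div]
    gcongr
    exact (abs_sub _ _).trans (by linarith [ha (N + 1), ha 1])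
  · have hBc : Continuous (birkhoffAverage ℂ τ F H) := by
      exact continuous_const.mul (continuous_finsetSum (Finset.range H) fun h _ =>
        hFc.comp ((hdiag v).iterate h))
    have h1 := (lim (φ := fun y => ‖birkhoffAverage ℂ τ F H y‖ ^ 2) ((C ^ Fintype.card ι) ^ 2)
      (hBc.norm.pow 2) fun y => by
      rw [norm_pow, norm_norm]
      exact pow_le_pow_left₀ (norm_nonneg _) (norm_birkhoffAverage_le_of_bound τ hFC H y) 2).add
        (lim_div (4 * H * (C ^ Fintype.card ι) ^ 2))
    rw [add_zero] at h1
    refine ge_of_tendsto h1 ?_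
    filter_upwards [hU0, hUS] with N hN hNS
    exact hNS.trans (X.integral_sq_norm_average_le v hFc.measurable hFC hN hH)

end PPSystem

/-! ### Ergodic averages and invariant sets -/

section Ergodic

variable {Ω : Type*} [MeasurableSpace Ω] {ν : Measure Ω} {τ : Ω → Ω}

/-- The `σ`-algebra of the measurable sets that are invariant under `τ` up to null sets. -/
@[reducible] def MeasureTheory.MeasurePreserving.aeInvariants (_hτ : MeasurePreserving τ ν ν) :
    MeasurableSpace Ω where
  MeasurableSet' A := MeasurableSet A ∧ τ ⁻¹' A =ᵐ[ν] A
  measurableSet_empty := ⟨MeasurableSet.empty, by simp⟩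
  measurableSet_compl _ hA := ⟨hA.1.compl, hA.2.compl⟩
  measurableSet_iUnion A hA := by
    refine ⟨MeasurableSet.iUnion fun i => (hA i).1, ?_⟩
    rw [Set.preimage_iUnion]
    exact Filter.EventuallyEq.countable_iUnion fun i => (hA i).2

theorem integral_sq_norm_eq_sq_norm_Lp (a : Lp ℂ 2 ν) : ∫ y, ‖a y‖ ^ 2 ∂ν = ‖a‖ ^ 2 := by
  have h := L2.inner_def (𝕜 := ℂ) a a
  simp only [inner_self_eq_norm_sq_to_K] at h
  have h2 : ∫ y, ((‖a y‖ : ℂ)) ^ 2 ∂ν = ((∫ y, ‖a y‖ ^ 2 ∂ν : ℝ) : ℂ) := by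
    rw [← integral_complex_ofReal]
    simp
  refine Complex.ofReal_injective ((h2.symm.trans h.symm).trans ?_)
  norm_cast

/-- The ergodic averages of the class of `F` in `L²` are represented by the pointwise ergodic
averages of `F`. -/
theorem coeFn_birkhoffAverage_compMeasurePreserving (hτ : MeasurePreserving τ ν ν) {F : Ω → ℂ}
    (hF : MemLp F 2 ν) (H : ℕ) :
    (birkhoffAverage ℂ (Lp.compMeasurePreserving (E := ℂ) (p := 2) τ hτ) id H hF.toLp :
      Lp ℂ 2 ν) =ᵐ[ν] birkhoffAverage ℂ τ F H := by
  have iter : ∀ h, (Lp.compMeasurePreserving (E := ℂ) (p := 2) τ hτ)^[h] hF.toLp =ᵐ[ν]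
      fun x => F (τ^[h] x) := fun h => by
    rw [Lp.compMeasurePreserving_iterate]
    exact (Lp.coeFn_compMeasurePreserving _ _).trans
      ((hτ.iterate h).quasiMeasurePreserving.ae_eq_comp hF.coeFn_toLp)
  have sum : (birkhoffSum (Lp.compMeasurePreserving (E := ℂ) (p := 2) τ hτ) id H hF.toLp :
      Lp ℂ 2 ν) =ᵐ[ν] birkhoffSum τ F H := by
    induction H with
    | zero => simpa [birkhoffSum] using Lp.coeFn_zero ℂ 2 ν
    | succ H ih =>
      rw [birkhoffSum_succ]
      filter_upwards [Lp.coeFn_add (birkhoffSum (Lp.compMeasurePreserving (E := ℂ) (p := 2) τ hτ)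
        id H hF.toLp) ((Lp.compMeasurePreserving (E := ℂ) (p := 2) τ hτ)^[H] hF.toLp), ih, iter H]
        with x h1 h2 h3
      rw [birkhoffSum_succ, ← h2, ← h3, ← Pi.add_apply, ← h1]
      rfl
  filter_upwards [Lp.coeFn_smul (H : ℂ)⁻¹
    (birkhoffSum (Lp.compMeasurePreserving (E := ℂ) (p := 2) τ hτ) id H hF.toLp), sum] with x h1 h2
  rw [birkhoffAverage, h1, Pi.smul_apply, h2, birkhoffAverage]

/-- If the ergodic averages of `F` do not become small in `L²`, then `F` has a nonzero integral over
some almost invariant set: otherwise the limit of the averages, which is an invariant function with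
the same integrals as `F` over the almost invariant sets, would vanish. -/
theorem exists_aeInvariant_setIntegral_ne_zero [IsProbabilityMeasure ν]
    (hτ : MeasurePreserving τ ν ν) {F : Ω → ℂ} (hF : MemLp F 2 ν) {ε : ℝ} (hε : 0 < ε)
    (h : ∀ H : ℕ, 0 < H → ε ≤ ∫ y, ‖birkhoffAverage ℂ τ F H y‖ ^ 2 ∂ν) :
    ∃ A, MeasurableSet A ∧ τ ⁻¹' A =ᵐ[ν] A ∧ ∫ y in A, F y ∂ν ≠ 0 := by
  set K := (Lp.compMeasurePreservingₗᵢ (E := ℂ) (p := 2) ℂ τ hτ).toContinuousLinearMap with hK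
  set V := K.eqLocus (1 : Lp ℂ 2 ν →L[ℂ] Lp ℂ 2 ν) with hV
  set g : V := V.orthogonalProjectionOnto hF.toLp with hg
  have hgK : Lp.compMeasurePreserving τ hτ (g : Lp ℂ 2 ν) = g := g.2
  have lim := K.tendsto_birkhoffAverage_orthogonalProjection
    (LinearIsometry.norm_toContinuousLinearMap_le _) hF.toLp
  have hgε : ε ≤ ‖(g : Lp ℂ 2 ν)‖ ^ 2 := by
    refine ge_of_tendsto (lim.norm.pow 2) ?_
    filter_upwards [eventually_gt_atTop 0] with H hH
    rw [← integral_sq_norm_eq_sq_norm_Lp]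
    refine (h H hH).trans_eq (integral_congr_ae ?_)
    filter_upwards [coeFn_birkhoffAverage_compMeasurePreserving hτ hF H] with x hx
    rw [← hx]
    rfl
  by_contra! hA
  have hle : hτ.aeInvariants ≤ ‹MeasurableSpace Ω› := fun A hA => hA.1
  have hgτ : (g : Lp ℂ 2 ν) ∘ τ =ᵐ[ν] (g : Lp ℂ 2 ν) := by
    have := Lp.coeFn_compMeasurePreserving (g : Lp ℂ 2 ν) hτ
    rw [hgK] at this
    exact this.symm
  have hgm : Measurable[hτ.aeInvariants] (g : Lp ℂ 2 ν) := fun s hs => by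
    refine ⟨(Lp.stronglyMeasurable (g : Lp ℂ 2 ν)).measurable hs, ?_⟩
    filter_upwards [hgτ] with x hx
    have : x ∈ τ ⁻¹' ((g : Lp ℂ 2 ν) ⁻¹' s) ↔ x ∈ (g : Lp ℂ 2 ν) ⁻¹' s := by
      simp only [Set.mem_preimage, ← hx, Function.comp_apply]
    exact propext this
  have hgint : Integrable (g : Lp ℂ 2 ν) ν := (Lp.memLp (g : Lp ℂ 2 ν)).integrable one_le_two
  have hgA : ∀ A, MeasurableSet[hτ.aeInvariants] A → ∫ y in A, (g : Lp ℂ 2 ν) y ∂ν = 0 := by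
    rintro A ⟨hAm, hAτ⟩
    have hmem : indicatorConstLp 2 hAm (measure_ne_top ν A) (1 : ℂ) ∈ V := by
      change Lp.compMeasurePreserving τ hτ _ = _
      rw [Lp.indicatorConstLp_compMeasurePreserving]
      refine Lp.ext (indicatorConstLp_coeFn.trans ?_)
      exact (indicator_ae_eq_of_ae_eq_set hAτ).trans
        (indicatorConstLp_coeFn (hs := hAm) (hμs := measure_ne_top ν A)).symm
    have := Submodule.inner_orthogonalProjectionOnto_eq_of_mem_left (K := V) ⟨_, hmem⟩ hF.toLp
    rw [← hg] at this
    change inner ℂ (indicatorConstLp 2 hAm (measure_ne_top ν A) (1 : ℂ)) (g : Lp ℂ 2 ν) =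
      inner ℂ (indicatorConstLp 2 hAm (measure_ne_top ν A) (1 : ℂ)) hF.toLp at this
    rw [L2.inner_indicatorConstLp_one, L2.inner_indicatorConstLp_one] at this
    rw [this, ← hA A hAm hAτ]
    exact setIntegral_congr_ae hAm (hF.coeFn_toLp.mono fun x hx _ => hx)
  have hg0 : (g : Lp ℂ 2 ν) =ᵐ[ν] 0 :=
    ae_eq_of_forall_setIntegral_eq_of_sigmaFinite' hle (fun _ _ _ => hgint.integrableOn)
      (fun _ _ _ => (integrable_zero _ _ _).integrableOn)
      (fun A hA _ => by simpa using hgA A hA)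
      hgm.stronglyMeasurable.aestronglyMeasurable stronglyMeasurable_zero.aestronglyMeasurable
  have : (g : Lp ℂ 2 ν) = 0 := (Lp.eq_zero_iff_ae_eq_zero).2 hg0
  rw [this] at hgε
  simp at hgε
  linarith

theorem tendsto_eLpNorm_two_of_tendsto_integral [IsProbabilityMeasure ν] {S : ℕ → Ω → ℂ}
    (hS : ∀ N, MemLp (S N) 2 ν)
    (h : Tendsto (fun N => ∫ x, ‖S N x‖ ^ 2 ∂ν) atTop (𝓝 0)) :
    Tendsto (fun N => eLpNorm (S N) 2 ν) atTop (𝓝 0) := by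
  have h1 : ∀ N, eLpNorm (S N) 2 ν = ENNReal.ofReal ((∫ x, ‖S N x‖ ^ 2 ∂ν) ^ (2⁻¹ : ℝ)) := by
    intro N
    rw [(hS N).eLpNorm_eq_integral_rpow_norm two_ne_zero ENNReal.ofNat_ne_top]
    simp
  simp only [h1]
  have h2 := h.rpow_const (p := (2⁻¹ : ℝ)) (Or.inr (by norm_num))
  rw [Real.zero_rpow (by norm_num)] at h2
  simpa using ENNReal.tendsto_ofReal h2

end Ergodic

/-! ### Classes of systems and their maximal factors -/

namespace PPSystem

variable {Γ : Type v} [AddCommGroup Γ]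

theorem isFactorMap_id (X : PPSystem.{u} Γ) : IsFactorMap X X id :=
  ⟨MeasurePreserving.id _, fun _ => rfl⟩

theorem IsFactorMap.comp {X Y Z : PPSystem.{u} Γ} {ψ : Y.carrier → Z.carrier}
    {π : X.carrier → Y.carrier} (hψ : IsFactorMap Y Z ψ) (hπ : IsFactorMap X Y π) :
    IsFactorMap X Z (ψ ∘ π) := by
  refine ⟨hψ.measurePreserving.comp hπ.measurePreserving, fun γ => ?_⟩
  rw [← Function.comp_assoc, hψ.equivariant, Function.comp_assoc, hπ.equivariant,
    ← Function.comp_assoc]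

theorem IsFactorMap.preimage_ae_eq {X Y : PPSystem.{u} Γ} {π : X.carrier → Y.carrier}
    (hπ : IsFactorMap X Y π) {s t : Set Y.carrier} (h : s =ᵐ[Y.μ] t) :
    π ⁻¹' s =ᵐ[X.μ] π ⁻¹' t :=
  hπ.measurePreserving.quasiMeasurePreserving.preimage_ae_eq h

/-- The one-point system. -/
noncomputable def trivialSystem (Γ : Type v) [AddCommGroup Γ] : PPSystem.{u} Γ where
  carrier := PUnit
  μ := Measure.dirac PUnit.unit
  T _ := id
  T_zero := rfl
  T_add _ _ := rfl
  T_measurePreserving _ := MeasurePreserving.id _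

theorem isFactorMap_trivialSystem (X : PPSystem.{u} Γ) :
    IsFactorMap X (trivialSystem Γ) (fun _ => PUnit.unit) := by
  refine ⟨⟨measurable_const, ?_⟩, fun _ => rfl⟩
  have h := Measure.map_const X.μ PUnit.unit.{u + 1}
  rw [measure_univ, one_smul] at h
  exact h

theorem zzero_trivialSystem (Λ : AddSubgroup Γ) : Zzero Λ (trivialSystem.{u} Γ) :=
  fun _ _ => ae_eq_refl _

/-- Triviality of the action of a cyclic subgroup may be tested on a generator. -/
theorem zzero_zmultiples {X : PPSystem.{u} Γ} {w : Γ} (h : X.T w =ᵐ[X.μ] id) :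
    Zzero (AddSubgroup.zmultiples w) X := by
  let S : AddSubgroup Γ :=
    { carrier := {γ | X.T γ =ᵐ[X.μ] id}
      zero_mem' := by simp [X.T_zero]
      add_mem' := fun {γ δ} hγ hδ => by
        simp only [Set.mem_ofPred_eq, X.T_add] at *
        exact ((X.T_measurePreserving δ).quasiMeasurePreserving.ae_eq_comp hγ).trans hδ
      neg_mem' := fun {γ} hγ => by
        have := (X.T_measurePreserving (-γ)).quasiMeasurePreserving.ae_eq_comp hγ
        rw [← X.T_add, add_neg_cancel, X.T_zero] at this
        exact this.symm }
  exact fun γ hγ => (AddSubgroup.zmultiples_le (H := S)).2 h hγ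

/-- A system is the joining of itself with the one-point system. -/
theorem join_of_left {C D : SystemClass.{u} Γ} {X : PPSystem.{u} Γ} (hX : C X)
    (hD : D (trivialSystem Γ)) : join C D X :=
  ⟨X, trivialSystem Γ, id, fun _ => PUnit.unit, hX, hD, X.isFactorMap_id,
    X.isFactorMap_trivialSystem, fun s hs =>
      ⟨s, (le_sup_left : X.mspace.comap id ≤ _) s ⟨s, hs, rfl⟩, ae_eq_refl _⟩⟩

theorem join_of_right {C D : SystemClass.{u} Γ} {X : PPSystem.{u} Γ} (hX : D X)
    (hC : C (trivialSystem Γ)) : join C D X :=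
  ⟨trivialSystem Γ, X, fun _ => PUnit.unit, id, hC, hX, X.isFactorMap_trivialSystem,
    X.isFactorMap_id, fun s hs =>
      ⟨s, (le_sup_right : X.mspace.comap id ≤ _) s ⟨s, hs, rfl⟩, ae_eq_refl _⟩⟩

theorem iJoin_of_mem {ι : Type} [Fintype ι] {C : ι → SystemClass.{u} Γ} {X : PPSystem.{u} Γ}
    (j : ι) (hX : C j X) (hC : ∀ i, C i (trivialSystem Γ)) : iJoin C X := by
  have : ∀ i, ∃ (Y : PPSystem.{u} Γ) (π : X.carrier → Y.carrier), C i Y ∧ IsFactorMap X Y π ∧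
      (i = j → X.mspace ≤ Y.mspace.comap π) := by
    intro i
    by_cases hij : i = j
    · subst hij
      exact ⟨X, id, hX, X.isFactorMap_id, fun _ s hs => ⟨s, hs, rfl⟩⟩
    · exact ⟨trivialSystem Γ, fun _ => PUnit.unit, hC i, X.isFactorMap_trivialSystem,
        fun h => absurd h hij⟩
  choose Y π hY hπ hle using this
  exact ⟨Y, π, hY, hπ, fun s hs => ⟨s,
    (le_iSup (fun i => (Y i).mspace.comap (π i)) j) s (hle j rfl s hs), ae_eq_refl _⟩⟩

theorem iJoin_trivialSystem {ι : Type} [Fintype ι] {C : ι → SystemClass.{u} Γ}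
    (hC : ∀ i, C i (trivialSystem Γ)) : iJoin C (trivialSystem Γ) := by
  refine ⟨fun _ => trivialSystem Γ, fun _ => id, hC, fun _ => isFactorMap_id _, fun s _ => ?_⟩
  rcases Set.eq_empty_or_nonempty s with rfl | ⟨x, hx⟩
  · exact ⟨∅, MeasurableSpace.measurableSet_empty _, ae_eq_refl _⟩
  · have : s = Set.univ := Set.eq_univ_of_forall fun y => by
      have hxy : x = y := rfl
      rwa [← hxy]
    exact ⟨Set.univ, MeasurableSet.univ, this ▸ ae_eq_refl _⟩

theorem charClass_of_zzero {k : ℕ} {X : PPSystem.{u} (Fin (k + 1) → ℤ)}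
    (h : Zzero (AddSubgroup.zmultiples (e 0)) X) : charClass k X :=
  join_of_left h (iJoin_trivialSystem fun _ => zzero_trivialSystem _)

theorem charClass_of_zzero_sub {k : ℕ} {X : PPSystem.{u} (Fin (k + 1) → ℤ)} (j : Fin k)
    (h : Zzero (AddSubgroup.zmultiples (e 0 - e j.succ)) X) : charClass k X :=
  join_of_right (iJoin_of_mem j h fun _ => zzero_trivialSystem _) (zzero_trivialSystem _)

theorem comap_le_maxFactor {C : SystemClass.{u} Γ} {X Y : PPSystem.{u} Γ}
    {π : X.carrier → Y.carrier} (hY : C Y) (hπ : IsFactorMap X Y π) :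
    Y.mspace.comap π ≤ maxFactor C X :=
  le_sSup ⟨Y, π, hY, hπ, rfl⟩

theorem maxFactor_le (C : SystemClass.{u} Γ) (X : PPSystem.{u} Γ) : maxFactor C X ≤ X.mspace := by
  refine sSup_le ?_
  rintro _ ⟨Y, π, -, hπ, rfl⟩
  exact hπ.measurePreserving.measurable.comap_le

theorem comap_le_invariantFactor {X Y : PPSystem.{u} Γ} {Λ : AddSubgroup Γ}
    {π : X.carrier → Y.carrier} (hY : Zzero Λ Y) (hπ : IsFactorMap X Y π) :
    Y.mspace.comap π ≤ X.invariantFactor Λ := by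
  rintro _ ⟨s, hs, rfl⟩
  refine ⟨hπ.measurePreserving.measurable hs, fun γ hγ => ?_⟩
  rw [← Set.preimage_comp, ← hπ.equivariant, Set.preimage_comp]
  refine hπ.preimage_ae_eq ?_
  filter_upwards [hY γ hγ] with y hy
  have : y ∈ Y.T γ ⁻¹' s ↔ y ∈ s := by rw [Set.mem_preimage, hy, id]
  exact propext this

/-- The `σ`-algebra of the sets that agree with a member of `m` off a `ν`-null set. -/
@[reducible] def nullEnlargement {Ω : Type*} (m : MeasurableSpace Ω) {m₀ : MeasurableSpace Ω}
    (ν : Measure Ω) : MeasurableSpace Ω :=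
  eventuallyMeasurableSpace m (ae ν)

theorem le_nullEnlargement {Ω : Type*} (m : MeasurableSpace Ω) {m₀ : MeasurableSpace Ω}
    (ν : Measure Ω) : m ≤ nullEnlargement m ν :=
  fun s hs => ⟨s, hs, ae_eq_refl _⟩

/-- Joinings inherit upper bounds, up to null sets, on the factors generated by their members. -/
theorem comap_le_nullEnlargement {X Y : PPSystem.{u} Γ} {π : X.carrier → Y.carrier}
    (hπ : IsFactorMap X Y π) {m : MeasurableSpace Y.carrier} {Ψ : MeasurableSpace X.carrier}
    (hm : LEModNull Y.μ Y.mspace m) (h : m.comap π ≤ nullEnlargement Ψ X.μ) :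
    Y.mspace.comap π ≤ nullEnlargement Ψ X.μ := by
  rintro _ ⟨s, hs, rfl⟩
  obtain ⟨t, ht, hst⟩ := hm s hs
  obtain ⟨r, hr, htr⟩ := h _ ⟨t, ht, rfl⟩
  exact ⟨r, hr, (hπ.preimage_ae_eq hst).trans htr⟩

/-- The maximal factor for the class `charClass k` is contained in `charFactor` up to null sets:
factor maps to systems on which a subgroup acts trivially generate invariant sets. -/
theorem maxFactor_charClass_le {k : ℕ} (X : PPSystem.{u} (Fin (k + 1) → ℤ)) :
    LEModNull X.μ (maxFactor (charClass k) X) X.charFactor := by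
  have : maxFactor (charClass k) X ≤ nullEnlargement X.charFactor X.μ := by
    refine sSup_le ?_
    rintro _ ⟨Y, π, ⟨Y₁, Z, π₁, ψ, hY₁, ⟨W, ω, hW, hω, hWle⟩, hπ₁, hψ, hYle⟩, hπ, rfl⟩
    refine comap_le_nullEnlargement hπ hYle ?_
    rw [MeasurableSpace.comap_sup, MeasurableSpace.comap_comp, MeasurableSpace.comap_comp]
    refine sup_le ?_ (comap_le_nullEnlargement (hψ.comp hπ) hWle ?_)
    · exact (comap_le_invariantFactor hY₁ (hπ₁.comp hπ)).trans
        (le_sup_left.trans (le_nullEnlargement _ _))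
    · rw [MeasurableSpace.comap_iSup]
      refine iSup_le fun j => ?_
      rw [MeasurableSpace.comap_comp]
      exact (comap_le_invariantFactor (hW j) ((hω j).comp (hψ.comp hπ))).trans
        (((le_iSup (fun j : Fin k => X.invariantFactor
          (AddSubgroup.zmultiples (e 0 - e j.succ))) j).trans le_sup_right).trans
          (le_nullEnlargement _ _))
  exact fun s hs => this s hs

/-! ### Factors generated by an almost invariant set -/

section Symbolic

variable {Γ : Type} [AddCommGroup Γ]

/-- The name of the point `x` with respect to a set `A`: it records which of the points `T^γ x` lie
in `A`. -/
noncomputable def symbolicName (X : PPSystem.{u} Γ) (A : Set X.carrier) (x : X.carrier) :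
    Γ → ULift.{u} Bool :=
  open Classical in fun γ => ⟨decide (X.T γ x ∈ A)⟩

theorem measurable_symbolicName (X : PPSystem.{u} Γ) {A : Set X.carrier} (hA : MeasurableSet A) :
    Measurable (X.symbolicName A) := by
  classical
  refine measurable_pi_lambda _ fun γ => MeasurableEquiv.ulift.symm.measurable.comp ?_
  refine measurable_to_bool ?_
  convert (X.T_measurePreserving γ).measurable hA using 1
  ext x
  simp

theorem symbolicName_T (X : PPSystem.{u} Γ) (A : Set X.carrier) (γ : Γ) (x : X.carrier) :
    X.symbolicName A (X.T γ x) = fun δ => X.symbolicName A x (δ + γ) := by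
  funext δ
  simp only [symbolicName]
  rw [T_T]

/-- The factor of `X` generated by a measurable set `A`: the shift on the space of sequences indexed
by `Γ`, with the law of the name of a random point with respect to `A`. -/
noncomputable def symbolicFactor [Countable Γ] (X : PPSystem.{u} Γ) {A : Set X.carrier}
    (hA : MeasurableSet A) : PPSystem.{u} Γ where
  carrier := Γ → ULift.{u} Bool
  μ := X.μ.map (X.symbolicName A)
  prob := Measure.isProbabilityMeasure_map (X.measurable_symbolicName hA).aemeasurable
  T γ y δ := y (δ + γ)
  T_zero := by simp only [add_zero]; rfl
  T_add γ γ' := by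
    funext y δ
    simp only [Function.comp_apply, add_assoc]
  T_measurePreserving γ := by
    have hshift : Measurable fun (y : Γ → ULift.{u} Bool) δ => y (δ + γ) :=
      measurable_pi_lambda _ fun δ => measurable_pi_apply _
    refine ⟨hshift, ?_⟩
    rw [Measure.map_map hshift (X.measurable_symbolicName hA)]
    conv_rhs => rw [← (X.T_measurePreserving γ).map_eq, Measure.map_map
      (X.measurable_symbolicName hA) (X.T_measurePreserving γ).measurable]
    congr 1
    funext x
    exact (X.symbolicName_T A γ x).symm

theorem isFactorMap_symbolicFactor [Countable Γ] (X : PPSystem.{u} Γ) {A : Set X.carrier}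
    (hA : MeasurableSet A) : IsFactorMap X (X.symbolicFactor hA) (X.symbolicName A) :=
  ⟨⟨X.measurable_symbolicName hA, rfl⟩, fun γ => funext fun x => (X.symbolicName_T A γ x).symm⟩

theorem measurableSet_comap_symbolicName [Countable Γ] (X : PPSystem.{u} Γ) {A : Set X.carrier}
    (hA : MeasurableSet A) :
    MeasurableSet[(X.symbolicFactor hA).mspace.comap (X.symbolicName A)] A := by
  refine ⟨(fun y : Γ → ULift.{u} Bool => y 0) ⁻¹' {⟨true⟩},
    measurable_pi_apply (X := fun _ : Γ => ULift.{u} Bool) 0 (MeasurableSet.singleton _), ?_⟩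
  ext x
  simp [symbolicName, X.T_zero]

theorem zzero_symbolicFactor [Countable Γ] (X : PPSystem.{u} Γ) {A : Set X.carrier}
    (hA : MeasurableSet A) {w : Γ} (h : X.T w ⁻¹' A =ᵐ[X.μ] A) :
    Zzero (AddSubgroup.zmultiples w) (X.symbolicFactor hA) := by
  classical
  refine zzero_zmultiples ?_
  have hshift : Measurable fun (y : Γ → ULift.{u} Bool) δ => y (δ + w) :=
    measurable_pi_lambda _ fun δ => measurable_pi_apply _
  suffices ∀ᵐ y ∂X.μ.map (X.symbolicName A), (fun δ => y (δ + w)) = y from this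
  rw [ae_map_iff (X.measurable_symbolicName hA).aemeasurable
    (measurableSet_eq_fun hshift (g := fun y => y) measurable_id)]
  have : ∀ᵐ x ∂X.μ, ∀ γ : Γ, (X.T (γ + w) x ∈ A ↔ X.T γ x ∈ A) := by
    refine ae_all_iff.2 fun γ => ?_
    have := (X.T_measurePreserving γ).quasiMeasurePreserving.preimage_ae_eq h
    filter_upwards [this] with x hx
    rw [add_comm, ← T_T]
    exact hx.to_iff
  filter_upwards [this] with x hx
  funext γ
  exact congrArg ULift.up (decide_eq_decide.2 (hx γ))

end Symbolic

end PPSystem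

/-! ### Twisted product systems -/

namespace PPSystem

section Product

variable {Γ : Type v} [AddCommGroup Γ] {ι : Type} [Countable ι]

/-- The system with the same underlying space as `X` on which `γ` acts by `T^{ρ γ}`. -/
def pullback (X : PPSystem.{u} Γ) (ρ : Γ →+ Γ) : PPSystem.{u} Γ where
  carrier := X.carrier
  μ := X.μ
  T γ := X.T (ρ γ)
  T_zero := by rw [map_zero, X.T_zero]
  T_add γ δ := by rw [map_add, X.T_add]
  T_measurePreserving γ := X.T_measurePreserving (ρ γ)

/-- The system on `X^ι`, with an invariant measure `ν`, on which `γ` acts by `T^{ρ_i γ}` on the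
`i`-th coordinate. -/
def productSystem (X : PPSystem.{u} Γ) (ρ : ι → Γ →+ Γ) (ν : Measure (ι → X.carrier))
    [IsProbabilityMeasure ν]
    (h : ∀ γ, MeasurePreserving (fun (x : ι → X.carrier) i => X.T (ρ i γ) (x i)) ν ν) :
    PPSystem.{u} Γ where
  carrier := ι → X.carrier
  μ := ν
  T γ x i := X.T (ρ i γ) (x i)
  T_zero := by
    funext x i
    rw [map_zero, X.T_zero]
    rfl
  T_add γ δ := by
    funext x i
    rw [map_add, X.T_add]
    rfl
  T_measurePreserving := h

theorem isFactorMap_eval (X : PPSystem.{u} Γ) (ρ : ι → Γ →+ Γ) (ν : Measure (ι → X.carrier))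
    [IsProbabilityMeasure ν]
    (h : ∀ γ, MeasurePreserving (fun (x : ι → X.carrier) i => X.T (ρ i γ) (x i)) ν ν) (i : ι)
    (hi : MeasurePreserving (fun x : ι → X.carrier => x i) ν X.μ) :
    IsFactorMap (X.productSystem ρ ν h) (X.pullback (ρ i)) (fun x => x i) :=
  ⟨hi, fun _ => rfl⟩

end Product

/-- The endomorphism of `ℤ^d` that sends the first basis vector to `e i` and fixes all the other
basis vectors. -/
def replaceFirst {k : ℕ} (i : Fin (k + 1)) : (Fin (k + 1) → ℤ) →+ (Fin (k + 1) → ℤ) where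
  toFun γ := (γ - γ 0 • e 0) + γ 0 • e i
  map_zero' := by simp
  map_add' γ δ := by
    simp only [Pi.add_apply, add_smul]
    abel

theorem replaceFirst_apply {k : ℕ} (i : Fin (k + 1)) (γ : Fin (k + 1) → ℤ) :
    replaceFirst i γ = (γ - γ 0 • e 0) + γ 0 • e i := rfl

theorem replaceFirst_zero {k : ℕ} (γ : Fin (k + 1) → ℤ) : replaceFirst 0 γ = γ := by
  simp [replaceFirst_apply]

theorem replaceFirst_e_zero {k : ℕ} (i : Fin (k + 1)) : replaceFirst i (e 0) = e i := by
  simp [replaceFirst_apply, e]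

theorem replaceFirst_succ_sub {k : ℕ} (j : Fin k) :
    replaceFirst j.succ (e 0 - e j.succ) = 0 := by
  have h : (e 0 - e j.succ : Fin (k + 1) → ℤ) 0 = 1 := by
    simp [e, (Fin.succ_ne_zero j).symm]
  rw [replaceFirst_apply, h]
  simp

/-- A measure that is invariant under the diagonal action and under `∏ i, T^{e_i}` is invariant
under the action of `ℤ^d` in which the first basis vector acts by `∏ i, T^{e_i}` and the others act
diagonally. -/
theorem measurePreserving_replaceFirst {k : ℕ} (X : PPSystem.{u} (Fin (k + 1) → ℤ))
    {ν : Measure (Fin (k + 1) → X.carrier)}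
    (hdiag : ∀ γ, MeasurePreserving (fun (x : Fin (k + 1) → X.carrier) i => X.T γ (x i)) ν ν)
    (hτ : MeasurePreserving (fun (x : Fin (k + 1) → X.carrier) i => X.T (e i) (x i)) ν ν)
    (γ : Fin (k + 1) → ℤ) :
    MeasurePreserving (fun (x : Fin (k + 1) → X.carrier) i => X.T (replaceFirst i γ) (x i))
      ν ν := by
  have hnat : ∀ n : ℕ, MeasurePreserving
      (fun (x : Fin (k + 1) → X.carrier) i => X.T (n • e i) (x i)) ν ν := by
    intro n
    induction n with
    | zero =>
      simp only [zero_smul, X.T_zero]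
      exact MeasurePreserving.id ν
    | succ n ih =>
      have := ih.comp hτ
      simp only [Function.comp_def, T_T, ← succ_nsmul] at this
      exact this
  have hint : ∀ n : ℤ, MeasurePreserving
      (fun (x : Fin (k + 1) → X.carrier) i => X.T (n • e i) (x i)) ν ν := by
    intro n
    obtain ⟨n, rfl | rfl⟩ := n.eq_nat_or_neg
    · simpa only [natCast_zsmul] using hnat n
    · have hmeas := X.measurable_diag fun i : Fin (k + 1) => (-(n : ℤ)) • (e i : Fin (k + 1) → ℤ)
      refine ⟨hmeas, ?_⟩
      conv_lhs => rw [← (hnat n).map_eq, Measure.map_map hmeas (hnat n).measurable]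
      have : (fun (x : Fin (k + 1) → X.carrier) i => X.T ((-(n : ℤ)) • e i) (x i)) ∘
          (fun (x : Fin (k + 1) → X.carrier) i => X.T (n • e i) (x i)) = id := by
        funext x i
        simp only [Function.comp_apply, T_T, neg_smul, natCast_zsmul, neg_add_cancel, X.T_zero]
        rfl
      rw [this, Measure.map_id]
  have := (hdiag (γ - γ 0 • e 0)).comp (hint (γ 0))
  simp only [Function.comp_def, T_T] at this
  exact this

/-! ### Partial characteristicity -/

theorem setIntegral_eq_zero_of_measurableSet_maxFactor {k : ℕ} (X : PPSystem.{u} (Fin (k + 1) → ℤ))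
    {f : X.carrier → ℂ} (hf : Integrable f X.μ) (h0 : X.μ[f|X.charFactor] =ᵐ[X.μ] 0)
    {s : Set X.carrier} (hs : MeasurableSet[maxFactor (charClass k) X] s) :
    ∫ x in s, f x ∂X.μ = 0 := by
  obtain ⟨t, ht, hst⟩ := X.maxFactor_charClass_le s hs
  rw [setIntegral_congr_set hst, ← setIntegral_condExp X.isFactor_charFactor.1 hf ht,
    integral_congr_ae (ae_restrict_of_ae h0)]
  simp

/-- A function with zero conditional expectation on `charFactor` has, after lifting to an extension,
zero conditional expectation on the lift of the maximal factor. -/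
theorem condExp_comap_maxFactor_eq_zero {k : ℕ} {X X' : PPSystem.{u} (Fin (k + 1) → ℤ)}
    {π : X'.carrier → X.carrier} (hπ : IsFactorMap X' X π) {f : X.carrier → ℂ} (hfm : Measurable f)
    (hf : Integrable f X.μ) (h0 : X.μ[f|X.charFactor] =ᵐ[X.μ] 0) :
    X'.μ[f ∘ π|(maxFactor (charClass k) X).comap π] =ᵐ[X'.μ] 0 := by
  have hle : (maxFactor (charClass k) X).comap π ≤ X'.mspace :=
    (MeasurableSpace.comap_mono (maxFactor_le _ X)).trans hπ.measurePreserving.measurable.comap_le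
  refine (ae_eq_condExp_of_forall_setIntegral_eq hle
    (hπ.measurePreserving.integrable_comp_of_integrable hf)
    (fun _ _ _ => (integrable_zero _ _ _).integrableOn) ?_
    stronglyMeasurable_zero.aestronglyMeasurable).symm
  rintro _ ⟨s, hs, rfl⟩ -
  have h := setIntegral_map (μ := X'.μ) (maxFactor_le _ X s hs)
    (hfm.aestronglyMeasurable (μ := X'.μ.map π)) hπ.measurePreserving.measurable.aemeasurable
  rw [hπ.measurePreserving.map_eq,
    X.setIntegral_eq_zero_of_measurableSet_maxFactor hf h0 hs] at h
  rw [Function.comp_def, ← h]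
  simp

/-- In the product system, the product of the indicator of a set that is almost invariant under the
first basis vector with functions of the coordinates other than the first is measurable for the
maximal factor. -/
theorem stronglyMeasurable_maxFactor_productSystem {k : ℕ} (X : PPSystem.{u} (Fin (k + 1) → ℤ))
    (ν : Measure (Fin (k + 1) → X.carrier)) [IsProbabilityMeasure ν]
    (hν : ∀ i, MeasurePreserving (fun x : Fin (k + 1) → X.carrier => x i) ν X.μ)
    (h : ∀ γ, MeasurePreserving
      (fun (x : Fin (k + 1) → X.carrier) i => X.T (replaceFirst i γ) (x i)) ν ν)
    {A : Set (Fin (k + 1) → X.carrier)} (hA : MeasurableSet A)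
    (hAτ : (fun (x : Fin (k + 1) → X.carrier) i => X.T (e i) (x i)) ⁻¹' A =ᵐ[ν] A)
    {f : Fin (k + 1) → X.carrier → ℂ} (hf : ∀ i, Measurable (f i)) :
    StronglyMeasurable[maxFactor (charClass k) (X.productSystem replaceFirst ν h)]
      fun x : Fin (k + 1) → X.carrier => A.indicator 1 x * ∏ j : Fin k, f j.succ (x j.succ) := by
  refine StronglyMeasurable.mul (stronglyMeasurable_one.indicator ?_)
    (Finset.stronglyMeasurable_fun_prod _ fun j _ => ?_)
  · set X' := X.productSystem replaceFirst ν h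
    have hA' : MeasurableSet[X'.mspace] A := hA
    have hinv : X'.T (e 0) ⁻¹' A =ᵐ[X'.μ] A := by
      have : X'.T (e 0) = fun (x : Fin (k + 1) → X.carrier) i => X.T (e i) (x i) := by
        funext x i
        change X.T (replaceFirst i (e 0)) (x i) = _
        rw [replaceFirst_e_zero]
      rw [this]
      exact hAτ
    exact comap_le_maxFactor (charClass_of_zzero (X'.zzero_symbolicFactor hA' hinv))
      (X'.isFactorMap_symbolicFactor hA') A (X'.measurableSet_comap_symbolicName hA')
  · have hz : Zzero (AddSubgroup.zmultiples (e 0 - e j.succ))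
        (X.pullback (replaceFirst j.succ)) := by
      refine zzero_zmultiples ?_
      change X.T (replaceFirst j.succ (e 0 - e j.succ)) =ᵐ[X.μ] id
      rw [replaceFirst_succ_sub, X.T_zero]
    exact ((hf j.succ).stronglyMeasurable.comp_measurable
      (comap_measurable fun x : Fin (k + 1) → X.carrier => x j.succ)).mono
      (comap_le_maxFactor (charClass_of_zzero_sub j hz)
        (X.isFactorMap_eval replaceFirst ν h j.succ (hν j.succ)))

/-- Partial characteristicity for everywhere bounded measurable functions: satedness is applied to
the twisted Furstenberg self-joining. -/
theorem tendsto_integral_sq_norm_avg {k : ℕ} (X : PPSystem.{u} (Fin (k + 1) → ℤ))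
    (hX : IsSated (charClass k) X) {f : Fin (k + 1) → X.carrier → ℂ} (hf : ∀ i, Measurable (f i))
    {C : ℝ} (hC : ∀ i x, ‖f i x‖ ≤ C) (h0 : X.μ[f 0|X.charFactor] =ᵐ[X.μ] 0) :
    Tendsto (fun N => ∫ x, ‖X.avg f N x‖ ^ 2 ∂X.μ) atTop (𝓝 0) := by
  by_contra hlim
  obtain ⟨ε, hε, hfreq⟩ : ∃ ε : ℝ, 0 < ε ∧ ∃ᶠ N in atTop, ε ≤ ∫ x, ‖X.avg f N x‖ ^ 2 ∂X.μ := by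
    by_contra! hcon
    refine hlim (tendsto_order.2 ⟨fun b hb => .of_forall fun N => hb.trans_le
      (integral_nonneg fun x => by positivity), fun b hb => ?_⟩)
    simpa only [not_frequently, not_le] using hcon b hb
  obtain ⟨ν, hνp, hν, hdiag, hτ, hεν⟩ := X.exists_furstenbergJoining e hf hC hfreq
  have hFm : Measurable fun x : Fin (k + 1) → X.carrier => ∏ i, f i (x i) :=
    Finset.measurable_prod _ fun i _ => (hf i).comp (measurable_pi_apply i)
  have hFC : ∀ x : Fin (k + 1) → X.carrier, ‖∏ i, f i (x i)‖ ≤ C ^ (k + 1) := fun x => by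
    rw [norm_prod]
    exact (Finset.prod_le_prod (fun i _ => norm_nonneg _) fun i _ => hC i (x i)).trans_eq (by simp)
  obtain ⟨A, hA, hAτ, hAF⟩ := exists_aeInvariant_setIntegral_ne_zero hτ
    (MemLp.of_bound hFm.aestronglyMeasurable _ (.of_forall hFC)) hε hεν
  have hT := X.measurePreserving_replaceFirst hdiag hτ
  have hπ : IsFactorMap (X.productSystem replaceFirst ν hT) X (fun x => x 0) := by
    refine ⟨hν 0, fun γ => funext fun x => ?_⟩
    change X.T γ (x 0) = X.T (replaceFirst 0 γ) (x 0)
    rw [replaceFirst_zero]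
  have hg := X.stronglyMeasurable_maxFactor_productSystem ν hν hT hA hAτ hf
  have hgm : Measurable fun x : Fin (k + 1) → X.carrier =>
      A.indicator (1 : (Fin (k + 1) → X.carrier) → ℂ) x * ∏ j : Fin k, f j.succ (x j.succ) :=
    (measurable_one.indicator hA).mul
      (Finset.measurable_prod _ fun j _ => (hf j.succ).comp (measurable_pi_apply j.succ))
  have hgb : ∀ x : Fin (k + 1) → X.carrier,
      ‖A.indicator (1 : (Fin (k + 1) → X.carrier) → ℂ) x * ∏ j : Fin k, f j.succ (x j.succ)‖ ≤
        C ^ k := fun x => by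
    have h1 : ‖A.indicator (1 : (Fin (k + 1) → X.carrier) → ℂ) x‖ ≤ 1 :=
      (norm_indicator_le_norm_self _ _).trans (by simp)
    have h2 : ‖∏ j : Fin k, f j.succ (x j.succ)‖ ≤ C ^ k := by
      rw [norm_prod]
      exact (Finset.prod_le_prod (fun j _ => norm_nonneg _)
        fun j _ => hC j.succ (x j.succ)).trans_eq (by simp)
    rw [norm_mul]
    exact (mul_le_mul h1 h2 (norm_nonneg _) zero_le_one).trans_eq (one_mul _)
  have hf0 : MemLp (f 0) ∞ X.μ :=
    memLp_top_of_bound (hf 0).aestronglyMeasurable C (.of_forall (hC 0))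
  have key := hX _ _ hπ (fun x => f 0 (x 0))
    (fun x => A.indicator 1 x * ∏ j : Fin k, f j.succ (x j.succ))
    ((hf 0).stronglyMeasurable.comp_measurable (comap_measurable _))
    (memLp_top_of_bound ((hf 0).comp (measurable_pi_apply 0)).aestronglyMeasurable C
      (.of_forall fun x => hC 0 _))
    hg (memLp_top_of_bound hgm.aestronglyMeasurable _ (.of_forall hgb))
  have hzero := condExp_comap_maxFactor_eq_zero hπ (hf 0) (hf0.integrable le_top) h0
  refine hAF ?_
  rw [← integral_indicator hA]
  have : ∀ x : Fin (k + 1) → X.carrier, A.indicator (fun x => ∏ i, f i (x i)) x =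
      f 0 (x 0) * (A.indicator 1 x * ∏ j : Fin k, f j.succ (x j.succ)) := fun x => by
    by_cases hx : x ∈ A <;> simp [hx, Fin.prod_univ_succ]
  simp only [this]
  refine Eq.trans key ?_
  rw [integral_eq_zero_of_ae]
  filter_upwards [hzero] with x hx
  refine mul_eq_zero_of_left hx _

theorem exists_measurable_bounded_ae_eq {Ω : Type*} [MeasurableSpace Ω] {μ : Measure Ω} {f : Ω → ℂ}
    (hf : MemLp f ∞ μ) : ∃ g : Ω → ℂ, Measurable g ∧ (∃ C : ℝ, ∀ x, ‖g x‖ ≤ C) ∧ f =ᵐ[μ] g := by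
  set C := (eLpNorm f ∞ μ).toReal
  set g := hf.1.mk f
  have hg : Measurable g := hf.1.stronglyMeasurable_mk.measurable
  have hfg : f =ᵐ[μ] g := hf.1.ae_eq_mk
  have hfC : ∀ᵐ x ∂μ, ‖f x‖ ≤ C := by
    filter_upwards [enorm_ae_le_eLpNormEssSup f μ] with x hx
    rw [← eLpNorm_exponent_top] at hx
    exact (toReal_enorm (f x)).symm.trans_le (ENNReal.toReal_mono hf.2.ne hx)
  refine ⟨{x | ‖g x‖ ≤ C}.indicator g, hg.indicator (measurableSet_le hg.norm measurable_const),
    ⟨C, fun x => ?_⟩, ?_⟩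
  · by_cases hx : ‖g x‖ ≤ C
    · simp [hx]
    · rw [Set.indicator_of_notMem (by exact hx), norm_zero]
      exact ENNReal.toReal_nonneg
  · filter_upwards [hfg, hfC] with x hx hxC
    rw [hx] at hxC
    simp [hx, hxC]

theorem avg_ae_eq {k : ℕ} (X : PPSystem.{u} (Fin k → ℤ)) {f g : Fin k → X.carrier → ℂ}
    (h : ∀ i, f i =ᵐ[X.μ] g i) (N : ℕ) : X.avg f N =ᵐ[X.μ] X.avg g N := by
  have : ∀ᵐ x ∂X.μ, ∀ (n : ℕ) (i : Fin k), f i (X.T (n • e i) x) = g i (X.T (n • e i) x) :=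
    ae_all_iff.2 fun n => ae_all_iff.2 fun i =>
      (X.T_measurePreserving (n • e i)).quasiMeasurePreserving.ae_eq_comp (h i)
  filter_upwards [this] with x hx
  simp only [avg, hx]

theorem memLp_avg {k : ℕ} (X : PPSystem.{u} (Fin k → ℤ)) {f : Fin k → X.carrier → ℂ}
    (hf : ∀ i, Measurable (f i)) {C : ℝ} (hC : ∀ i x, ‖f i x‖ ≤ C) (N : ℕ) :
    MemLp (X.avg f N) 2 X.μ := by
  have hn : ∀ n ∈ Finset.Icc 1 N, MemLp (fun x => ∏ i, f i (X.T (n • e i) x)) 2 X.μ := fun n _ => by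
    refine MemLp.of_bound (Finset.measurable_prod _ fun i _ =>
      (hf i).comp (X.T_measurePreserving _).measurable).aestronglyMeasurable
      (C ^ k) (.of_forall fun x => ?_)
    rw [norm_prod]
    exact (Finset.prod_le_prod (fun i _ => norm_nonneg _) fun i _ => hC i _).trans_eq (by simp)
  exact (memLp_finsetSum _ hn).const_mul (N : ℂ)⁻¹

end PPSystem

theorem mainTheorem10 (k : ℕ) (X : PPSystem.{u} (Fin (k + 1) → ℤ))
    (hX : PPSystem.IsSated (PPSystem.charClass k) X)
    (f : Fin (k + 1) → X.carrier → ℂ) (hf : ∀ i, MemLp (f i) ∞ X.μ)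
    (hS : ¬ Tendsto (fun N : ℕ => eLpNorm (X.avg f N) 2 X.μ) atTop (𝓝 0)) :
    ¬ (X.μ[f 0|X.charFactor] =ᵐ[X.μ] 0) := by
  intro h0
  -- The integrands may be replaced by everywhere bounded measurable functions.
  choose g hg hgb hfg using fun i => PPSystem.exists_measurable_bounded_ae_eq (hf i)
  choose C hC using hgb
  have hgC : ∀ i x, ‖g i x‖ ≤ ∑ j, |C j| := fun i x => ((hC i x).trans (le_abs_self _)).trans
    (Finset.single_le_sum (f := fun j => |C j|) (fun j _ => abs_nonneg _) (Finset.mem_univ i))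
  refine hS ?_
  simp only [eLpNorm_congr_ae (X.avg_ae_eq hfg _)]
  exact tendsto_eLpNorm_two_of_tendsto_integral (X.memLp_avg hg hgC)
    (X.tendsto_integral_sq_norm_avg hX hg hgC ((condExp_congr_ae (hfg 0)).symm.trans h0))
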